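/- Let $(c_k)_{k\ge 1}$ be positive real numbers with $\sum_{k} c_k<\infty$, let $(\lambda_k)_{k\ge 1}$ be a strictly increasing bounded sequence of real numbers, and let $$f(z)=\sum_{k=1}^{\infty}\frac{c_k}{\lambda_k-z}$$ for $z\in D$, where $D$ is the set of all $z\in\mathbb{C}\setminus\{\lambda_1,\lambda_2,\dots\}$ at which the series converges. Then $D$ contains $\mathbb{C}\setminus(\{\lambda_k:k\ge1\}\cup\{\sup_k\lambda_k\})$, the series $\sum_k c_k\lambda_k$ converges, and the following hold. 1. All the zeros of $f$ in $D$ are real and simple. Each interval $(\lambda_{k-1},\lambda_k)$, $k\ge 2$, contains exactly one of them, and there are no others; thus they form a strictly increasing sequence $(t_n)_{n\ge1}$ with $\lambda_n<t_n<\lambda_{n+1}$. 2. The numbers $b_n=1/f'(t_n)$ are real and positive, and $\sum_{n} b_n<\infty$. 3. For every $z\in D$ with $f(z)\neq 0$ the series on the right converges and $$\frac1{f(z)}=\alpha+\beta z-\sum_{n=1}^{\infty}\frac{b_n}{t_n-z},\qquad \alpha=\frac{\sum_{k} c_k\lambda_k}{\left(\sum_{k} c_k\right)^2},\quad \beta=-\frac1{\sum_{k}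 c_k}.$$ -/

import Mathlib

/-- The sum `f(z) = ∑ c_k / (lam_k - z)` of a Wolff-Denjoy series with real coefficients and real
poles, indexed from `k = 0`. It is meaningful for `z` in `wolffDenjoyDomain c lam`. -/
noncomputable def wolffDenjoy (c lam : ℕ → ℝ) (z : ℂ) : ℂ :=
  ∑' k, (c k : ℂ) / ((lam k : ℂ) - z)

/-- The points, different from all the `lam_k`, at which the series `∑ c_k / (lam_k - z)`
converges. -/
def wolffDenjoyDomain (c lam : ℕ → ℝ) : Set ℂ :=
  {z | (∀ k, z ≠ (lam k : ℂ)) ∧ Summable fun k => (c k : ℂ) / ((lam k : ℂ) - z)}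

open Filter Topology
open scoped InnerProductSpace

/-! The imaginary part of `f z` is `im z` times a positive sum, so zeros are real. On a gap between
consecutive poles `f` is increasing and changes sign, and beyond all the poles it has constant sign.

The expansion of `1 / f` is Parseval's identity in ℓ². Let `e = √c`. The compression of `diag lam`
to the complement of `e` is self-adjoint, with eigenvalues `t n` and eigenvectors `v n = √c / (lam -
t n)`, where `‖v n‖ ^ 2 = f' (t n)`. It is a scalar plus a compact operator because `lam k`
converges, so `e` and the `v n` form a complete orthogonal family (`eq_zero_of_inner_eq_zero`).
Expanding the inner product of `a = lam * √c` and `y = √c / (lam - z)` in it, then dividing by `C *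
f z` with `C = ∑ c`, gives the formula (`hasSum_one_div_wolffDenjoy`). The point `sup lam`, if it
lies in the domain, is reached by a limit from the right. -/

/-! ### Convergence and holomorphy away from the poles. -/

theorem StrictMono.lt_ciSup_of_bddAbove {lam : ℕ → ℝ} (hlam : StrictMono lam)
    (hbdd : BddAbove (Set.range lam)) (k : ℕ) : lam k < ⨆ k, lam k :=
  (hlam k.lt_succ_self).trans_le (le_ciSup hbdd _)

/-- Off the closure of the poles, the distance to the poles is bounded below. -/
theorem exists_pos_le_norm_sub {lam : ℕ → ℝ} (hlam : StrictMono lam)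
    (hbdd : BddAbove (Set.range lam)) {z : ℂ} (hz : ∀ k, z ≠ (lam k : ℂ))
    (hz' : z ≠ ((⨆ k, lam k : ℝ) : ℂ)) : ∃ δ > 0, ∀ k, δ ≤ ‖(lam k : ℂ) - z‖ := by
  have ht : Tendsto (fun k => ‖(lam k : ℂ) - z‖) atTop (𝓝 ‖((⨆ k, lam k : ℝ) : ℂ) - z‖) :=
    (((Complex.continuous_ofReal.tendsto _).comp
      (tendsto_atTop_ciSup hlam.monotone hbdd)).sub_const z).norm
  have hpos : 0 < ‖((⨆ k, lam k : ℝ) : ℂ) - z‖ := norm_pos_iff.2 (sub_ne_zero.2 hz'.symm)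
  obtain ⟨N, hN⟩ := eventually_atTop.1 (ht.eventually (lt_mem_nhds (half_lt_self hpos)))
  have hfin : ∃ δ > 0, ∀ k < N, δ ≤ ‖(lam k : ℂ) - z‖ := by
    clear hN
    induction N with
    | zero => exact ⟨1, one_pos, by simp⟩
    | succ n ih =>
      obtain ⟨δ, hδ, h⟩ := ih
      have hn : 0 < ‖(lam n : ℂ) - z‖ := norm_pos_iff.2 (sub_ne_zero.2 (hz n).symm)
      refine ⟨min δ ‖(lam n : ℂ) - z‖, lt_min hδ hn, fun k hk => ?_⟩
      rcases Nat.lt_succ_iff_lt_or_eq.1 hk with hk | rfl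
      · exact (min_le_left _ _).trans (h k hk)
      · exact min_le_right _ _
  obtain ⟨δ, hδ, h⟩ := hfin
  refine ⟨min δ (‖((⨆ k, lam k : ℝ) : ℂ) - z‖ / 2), lt_min hδ (half_pos hpos), fun k => ?_⟩
  rcases lt_or_ge k N with hk | hk
  · exact (min_le_left _ _).trans (h k hk)
  · exact (min_le_right _ _).trans (hN k hk).le

theorem norm_div_sub_le {c : ℕ → ℝ} (hc : ∀ k, 0 < c k) {lam : ℕ → ℝ} {z : ℂ} {δ : ℝ} (hδ : 0 < δ)
    {k : ℕ} (h : δ ≤ ‖(lam k : ℂ) - z‖) : ‖(c k : ℂ) / ((lam k : ℂ) - z)‖ ≤ c k / δ := by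
  rw [norm_div, Complex.norm_real, Real.norm_of_nonneg (hc k).le]
  exact div_le_div_of_nonneg_left (hc k).le hδ h

theorem mem_wolffDenjoyDomain {c lam : ℕ → ℝ} (hc : ∀ k, 0 < c k) (hcsum : Summable c)
    (hlam : StrictMono lam) (hbdd : BddAbove (Set.range lam)) {z : ℂ}
    (hz : ∀ k, z ≠ (lam k : ℂ)) (hz' : z ≠ ((⨆ k, lam k : ℝ) : ℂ)) :
    z ∈ wolffDenjoyDomain c lam := by
  obtain ⟨δ, hδ, h⟩ := exists_pos_le_norm_sub hlam hbdd hz hz'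
  exact ⟨hz, .of_norm_bounded (hcsum.div_const δ) fun k => norm_div_sub_le hc hδ (h k)⟩

/-- On the ball of radius `δ / 2` every pole stays at distance at least `δ / 2`, so `c k / (δ / 2)`
is a Weierstrass majorant. -/
theorem differentiableOn_wolffDenjoy_ball {c lam : ℕ → ℝ} (hc : ∀ k, 0 < c k) (hcsum : Summable c)
    {z : ℂ} {δ : ℝ} (hδ : 0 < δ) (h : ∀ k, δ ≤ ‖(lam k : ℂ) - z‖) :
    DifferentiableOn ℂ (wolffDenjoy c lam) (Metric.ball z (δ / 2)) ∧
      HasSum (fun k => (c k : ℂ) / ((lam k : ℂ) - z) ^ 2) (deriv (wolffDenjoy c lam) z) := by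
  have hne : ∀ k, ∀ w ∈ Metric.ball z (δ / 2), δ / 2 ≤ ‖(lam k : ℂ) - w‖ := fun k w hw => by
    have h1 := norm_sub_norm_le ((lam k : ℂ) - z) (w - z)
    rw [sub_sub_sub_cancel_right] at h1
    rw [mem_ball_iff_norm] at hw
    linarith [h k]
  have hd : ∀ k, DifferentiableOn ℂ (fun w : ℂ => (c k : ℂ) / ((lam k : ℂ) - w))
      (Metric.ball z (δ / 2)) := fun k w hw =>
    ((differentiableAt_const _).div ((differentiableAt_const _).sub differentiableAt_id)
      (norm_pos_iff.1 ((half_pos hδ).trans_le (hne k w hw)))).differentiableWithinAt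
  have hb : ∀ k, ∀ w ∈ Metric.ball z (δ / 2),
      ‖(c k : ℂ) / ((lam k : ℂ) - w)‖ ≤ c k / (δ / 2) := fun k w hw =>
    norm_div_sub_le hc (half_pos hδ) (hne k w hw)
  refine ⟨Complex.differentiableOn_tsum_of_summable_norm (hcsum.div_const (δ / 2)) hd
    Metric.isOpen_ball hb, ?_⟩
  have := Complex.hasSum_deriv_of_summable_norm (hcsum.div_const (δ / 2)) hd
    Metric.isOpen_ball hb (Metric.mem_ball_self (half_pos hδ))
  convert! this using 1
  ext k
  have hk : (lam k : ℂ) - z ≠ 0 := norm_pos_iff.1 (hδ.trans_le (h k))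
  have := (((hasDerivAt_id z).const_sub (lam k : ℂ)).inv hk).const_mul (c k : ℂ)
  simpa [div_eq_mul_inv] using! this.deriv.symm

/-! ### Location of the zeros. -/

theorem wolffDenjoy_ofReal (c lam : ℕ → ℝ) (x : ℝ) :
    wolffDenjoy c lam x = ((∑' k, c k / (lam k - x) : ℝ) : ℂ) := by
  simp [wolffDenjoy, Complex.ofReal_tsum]

theorem summable_real_of_mem_wolffDenjoyDomain {c lam : ℕ → ℝ} {x : ℝ}
    (hx : (x : ℂ) ∈ wolffDenjoyDomain c lam) : Summable fun k => c k / (lam k - x) := by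
  have := hx.2
  exact_mod_cast this

theorem tsum_div_sub_neg {c lam : ℕ → ℝ} (hc : ∀ k, 0 < c k) {x : ℝ}
    (hx : ∀ k, lam k < x) (hs : Summable fun k => c k / (lam k - x)) :
    ∑' k, c k / (lam k - x) < 0 := by
  have h : ∀ k, c k / (lam k - x) < 0 := fun k => div_neg_of_pos_of_neg (hc k) (sub_neg.2 (hx k))
  have := hs.neg.tsum_pos (fun k => (neg_pos.2 (h k)).le) 0 (neg_pos.2 (h 0))
  rw [tsum_neg] at this
  linarith

/-- The zeros of the sum are real and lie in the gaps between the poles. -/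
theorem exists_mem_Ioo_of_wolffDenjoy_eq_zero {c lam : ℕ → ℝ} (hc : ∀ k, 0 < c k)
    (hlam : StrictMono lam) {z : ℂ} (hz : z ∈ wolffDenjoyDomain c lam)
    (h0 : wolffDenjoy c lam z = 0) :
    ∃ n, ∃ x ∈ Set.Ioo (lam n) (lam (n + 1)), z = (x : ℂ) := by
  have hre : z.im = 0 := by
    by_contra him
    have hs : HasSum (fun k => (c k : ℂ) / ((lam k : ℂ) - z)) 0 := h0 ▸ hz.2.hasSum
    have hi := (Complex.hasSum_im hs).div_const z.im
    have hterm : ∀ k, ((c k : ℂ) / ((lam k : ℂ) - z)).im / z.im =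
        c k / Complex.normSq ((lam k : ℂ) - z) := fun k => by
      rw [Complex.div_im]
      simp only [Complex.ofReal_im, Complex.ofReal_re, Complex.sub_im]
      field_simp
      ring
    simp only [hterm, Complex.zero_im, zero_div] at hi
    have hp : ∀ k, 0 < c k / Complex.normSq ((lam k : ℂ) - z) := fun k =>
      div_pos (hc k) (Complex.normSq_pos.2 (sub_ne_zero.2 (hz.1 k).symm))
    exact (hi.summable.tsum_pos (fun k => (hp k).le) 0 (hp 0)).ne' hi.tsum_eq
  obtain ⟨x, rfl⟩ : ∃ x : ℝ, z = x := ⟨z.re, Complex.ext rfl (by simpa using hre)⟩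
  have hs := summable_real_of_mem_wolffDenjoyDomain hz
  rw [wolffDenjoy_ofReal, Complex.ofReal_eq_zero] at h0
  have hne : ∀ k, x ≠ lam k := fun k => by exact_mod_cast hz.1 k
  have hex : ∃ k, x < lam k := by
    by_contra! hle
    exact (tsum_div_sub_neg hc (fun k => (hle k).lt_of_ne (hne k).symm) hs).ne h0
  classical
  have hk := Nat.find_spec hex
  -- The first pole to the right of `x` closes the gap; if it were `lam 0`, all terms would be
  -- positive.
  rcases hn : Nat.find hex with _ | n
  · rw [hn] at hk
    have hp : ∀ k, 0 < c k / (lam k - x) := fun k =>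
      div_pos (hc k) (sub_pos.2 (hk.trans_le (hlam.monotone k.zero_le)))
    exact absurd h0 (hs.tsum_pos (fun k => (hp k).le) 0 (hp 0)).ne'
  · rw [hn] at hk
    have := Nat.find_min hex (m := n) (by omega)
    exact ⟨n, x, ⟨(not_lt.1 this).lt_of_ne (hne n).symm, hk⟩, rfl⟩

theorem ne_of_mem_Ioo {lam : ℕ → ℝ} (hlam : StrictMono lam) {n : ℕ} {x : ℝ}
    (hx : x ∈ Set.Ioo (lam n) (lam (n + 1))) (k : ℕ) : (x : ℂ) ≠ (lam k : ℂ) := by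
  intro h
  rw [Complex.ofReal_inj.1 h, Set.mem_Ioo, hlam.lt_iff_lt, hlam.lt_iff_lt] at hx
  omega

theorem ne_ciSup_of_mem_Ioo {lam : ℕ → ℝ} (hbdd : BddAbove (Set.range lam)) {n : ℕ} {x : ℝ}
    (hx : x ∈ Set.Ioo (lam n) (lam (n + 1))) : (x : ℂ) ≠ ((⨆ k, lam k : ℝ) : ℂ) := fun h =>
  (hx.2.trans_le (le_ciSup hbdd _)).ne (Complex.ofReal_inj.1 h)

/-- Each term increases on an interval free of its pole, whichever side the pole lies on. -/
theorem tsum_div_sub_lt_of_mem_Ioo {c lam : ℕ → ℝ} (hc : ∀ k, 0 < c k) (hlam : StrictMono lam)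
    {n : ℕ} {x y : ℝ} (hx : x ∈ Set.Ioo (lam n) (lam (n + 1)))
    (hy : y ∈ Set.Ioo (lam n) (lam (n + 1))) (hxs : Summable fun k => c k / (lam k - x))
    (hys : Summable fun k => c k / (lam k - y)) (hxy : x < y) :
    ∑' k, c k / (lam k - x) < ∑' k, c k / (lam k - y) := by
  have h : ∀ k, c k / (lam k - x) < c k / (lam k - y) := fun k => by
    rcases le_or_gt k n with hk | hk
    · have h1 := hlam.monotone hk
      have h2 : c k / (x - lam k) > c k / (y - lam k) :=
        div_lt_div_of_pos_left (hc k) (by linarith [hx.1]) (by linarith)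
      rw [← neg_sub x, ← neg_sub y, div_neg, div_neg]
      linarith
    · have h1 := hlam.monotone (Nat.succ_le_of_lt hk)
      exact div_lt_div_of_pos_left (hc k) (by linarith [hy.2]) (by linarith)
  exact Summable.tsum_lt_tsum (fun k => (h k).le) (h 0) hxs hys

/-- Between two consecutive poles there is a zero. -/
theorem exists_wolffDenjoy_eq_zero {c lam : ℕ → ℝ} (hc : ∀ k, 0 < c k) (hcsum : Summable c)
    (hlam : StrictMono lam) (hbdd : BddAbove (Set.range lam)) (n : ℕ) :
    ∃ x ∈ Set.Ioo (lam n) (lam (n + 1)), wolffDenjoy c lam (x : ℂ) = 0 := by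
  set g := lam (n + 1) - lam n with hg
  have hgpos : 0 < g := sub_pos.2 (hlam n.lt_succ_self)
  set C := ∑' k, c k with hC
  have hcC : ∀ k, c k ≤ C := fun k => hcsum.le_tsum k fun j _ => (hc j).le
  have hCpos : 0 < C := (hc 0).trans_le (hcC 0)
  -- At this distance from pole `k` its own term has size exactly `2 * C / g`. The offset is at most
  -- `g / 2`, so any pole whose term has the opposite sign is at distance at least `g / 2` and
  -- contributes at most `2 * c j / g`; the near pole wins by `2 * c k / g`.
  have hε : ∀ k, 0 < c k * g / (2 * C) ∧ c k * g / (2 * C) ≤ g / 2 := fun k => by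
    refine ⟨by have := hc k; positivity, ?_⟩
    rw [div_le_div_iff₀ (by positivity) two_pos]
    nlinarith [mul_le_mul_of_nonneg_right (hcC k) hgpos.le]
  have hbound : ∀ k, HasSum (fun j => if j = k then -(2 * C / g) else 2 * c j / g)
      (-(2 * c k / g)) := fun k => by
    have h1 := (hcsum.hasSum.mul_left (2 / g)).update k (-(2 * C / g))
    rw [← hC] at h1
    convert! h1 using 1
    · ext j
      rw [Function.update_apply]
      split_ifs
      · rfl
      · ring
    · ring
  set x := lam n + c n * g / (2 * C) with hx
  set y := lam (n + 1) - c (n + 1) * g / (2 * C) with hy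
  obtain ⟨hε1, hε2⟩ := hε n
  obtain ⟨hε3, hε4⟩ := hε (n + 1)
  have hxy : x ≤ y := by linarith
  have hIcc : ∀ w ∈ Set.Icc x y, w ∈ Set.Ioo (lam n) (lam (n + 1)) := fun w hw =>
    ⟨by linarith [hw.1], by linarith [hw.2]⟩
  have hdom : ∀ w ∈ Set.Icc x y, (w : ℂ) ∈ wolffDenjoyDomain c lam := fun w hw =>
    mem_wolffDenjoyDomain hc hcsum hlam hbdd (ne_of_mem_Ioo hlam (hIcc w hw))
      (ne_ciSup_of_mem_Ioo hbdd (hIcc w hw))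
  have hsum := fun w hw => summable_real_of_mem_wolffDenjoyDomain (hdom w hw)
  have hFx : ∑' k, c k / (lam k - x) ≤ 0 := by
    refine (Summable.tsum_le_tsum (fun k => ?_) (hsum x ⟨le_rfl, hxy⟩)
      (hbound n).summable).trans ((hbound n).tsum_eq.le.trans ?_)
    · split_ifs with hk
      · subst hk
        have hck := hc k
        rw [hx, sub_add_cancel_left, div_neg]
        refine neg_le_neg (le_of_eq ?_)
        field_simp
      · rcases lt_or_gt_of_ne hk with hk | hk
        · have h1 := hlam hk
          exact (div_nonpos_of_nonneg_of_nonpos (hc k).le (by linarith)).trans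
            (by have := hc k; positivity)
        · have h1 := hlam.monotone (Nat.succ_le_of_lt hk)
          rw [Nat.succ_eq_add_one] at h1
          rw [mul_comm, mul_div_assoc, div_eq_mul_inv]
          refine mul_le_mul_of_nonneg_left ?_ (hc k).le
          rw [← inv_div]
          exact inv_anti₀ (by positivity) (by linarith)
    · have := hc n
      exact neg_nonpos.2 (by positivity)
  have hFy : 0 ≤ ∑' k, c k / (lam k - y) := by
    rw [← neg_nonpos, ← tsum_neg]
    refine (Summable.tsum_le_tsum (fun k => ?_) (hsum y ⟨hxy, le_rfl⟩).neg
      (hbound (n + 1)).summable).trans ((hbound (n + 1)).tsum_eq.le.trans ?_)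
    · split_ifs with hk
      · subst hk
        have hck := hc (n + 1)
        rw [hy, sub_sub_cancel]
        refine neg_le_neg (le_of_eq ?_)
        field_simp
      · rcases lt_or_gt_of_ne hk with hk | hk
        · have h1 := hlam.monotone (Nat.lt_succ_iff.1 hk)
          rw [← div_neg, neg_sub, mul_comm, mul_div_assoc, div_eq_mul_inv]
          refine mul_le_mul_of_nonneg_left ?_ (hc k).le
          rw [← inv_div]
          exact inv_anti₀ (by positivity) (by linarith)
        · have h1 := hlam hk
          refine (neg_nonpos.2 (div_nonneg (hc k).le (by linarith))).trans
            (by have := hc k; positivity)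
    · have := hc (n + 1)
      exact neg_nonpos.2 (by positivity)
  have hcont : ContinuousOn (fun w : ℝ => (wolffDenjoy c lam w).re) (Set.Icc x y) := fun w hw => by
    obtain ⟨δ, hδ, h⟩ := exists_pos_le_norm_sub hlam hbdd (ne_of_mem_Ioo hlam (hIcc w hw))
      (ne_ciSup_of_mem_Ioo hbdd (hIcc w hw))
    have hd := (differentiableOn_wolffDenjoy_ball hc hcsum hδ h).1.differentiableAt
      (Metric.ball_mem_nhds _ (half_pos hδ))
    have h2 : ContinuousAt (fun w : ℝ => wolffDenjoy c lam w) w :=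
      ContinuousAt.comp (g := wolffDenjoy c lam) (f := fun w : ℝ => (w : ℂ)) hd.continuousAt
        Complex.continuous_ofReal.continuousAt
    exact (Complex.continuous_re.continuousAt.comp h2).continuousWithinAt
  simp only [wolffDenjoy_ofReal, Complex.ofReal_re] at hcont
  obtain ⟨w, hw, hw0⟩ := intermediate_value_Icc hxy hcont ⟨hFx, hFy⟩
  exact ⟨w, hIcc w hw, by rw [wolffDenjoy_ofReal]; exact_mod_cast hw0⟩

/-! ### Diagonal operators and orthogonal expansions in ℓ². -/

/-- The diagonal operator on `ℓ²` with a bounded symbol. -/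
theorem exists_diagonal_clm {d : ℕ → ℂ} {B : ℝ} (hB : 0 ≤ B) (hd : ∀ k, ‖d k‖ ≤ B) :
    ∃ D : lp (fun _ : ℕ => ℂ) 2 →L[ℂ] lp (fun _ : ℕ => ℂ) 2,
      (∀ x k, D x k = d k * x k) ∧ ‖D‖ ≤ B := by
  have hle : ∀ (x : lp (fun _ : ℕ => ℂ) 2) k, ‖d k * x k‖ ≤ ‖((B : ℂ) • x) k‖ := fun x k => by
    rw [lp.coeFn_smul, Pi.smul_apply, norm_mul, norm_smul, Complex.norm_real,
      Real.norm_of_nonneg hB]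
    exact mul_le_mul_of_nonneg_right (hd k) (norm_nonneg _)
  let D : lp (fun _ : ℕ => ℂ) 2 →ₗ[ℂ] lp (fun _ : ℕ => ℂ) 2 :=
    { toFun := fun x => ⟨fun k => d k * x k, (lp.memℓp ((B : ℂ) • x)).mono' (hle x)⟩
      map_add' := fun x y => by ext k; exact mul_add _ _ _
      map_smul' := fun a x => by ext k; exact mul_left_comm _ _ _ }
  refine ⟨D.mkContinuous B fun x => ?_, fun _ _ => rfl, D.mkContinuous_norm_le hB _⟩
  refine (lp.norm_mono (by simp) (hle x)).trans_eq ?_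
  rw [norm_smul, Complex.norm_real, Real.norm_of_nonneg hB]

/-- A diagonal operator on `ℓ²` whose symbol tends to zero is compact. -/
theorem isCompactOperator_of_diagonal {d : ℕ → ℂ} (hd : Tendsto d atTop (𝓝 0))
    {D : lp (fun _ : ℕ => ℂ) 2 →L[ℂ] lp (fun _ : ℕ => ℂ) 2} (hD : ∀ x k, D x k = d k * x k) :
    IsCompactOperator D := by
  -- Finite-rank truncations; the error is diagonal with a uniformly small symbol.
  let F : ℕ → lp (fun _ : ℕ => ℂ) 2 →L[ℂ] lp (fun _ : ℕ => ℂ) 2 := fun N =>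
    ∑ k ∈ Finset.range N, d k • (lp.singleContinuousLinearMap ℂ (fun _ : ℕ => ℂ) 2 k ∘L
      lp.evalCLM ℂ (fun _ : ℕ => ℂ) 2 k)
  have hF : ∀ N x j, F N x j = if j < N then d j * x j else 0 := fun N x j => by
    simp only [F, sum_apply, lp.coeFn_sum, Finset.sum_apply]
    have : ∀ k, ((d k • (lp.singleContinuousLinearMap ℂ (fun _ : ℕ => ℂ) 2 k ∘L
        lp.evalCLM ℂ (fun _ : ℕ => ℂ) 2 k)) x) j = if j = k then d k * x k else 0 := fun k => by
      change d k * (lp.single (E := fun _ : ℕ => ℂ) 2 k (x k)) j = _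
      rcases eq_or_ne j k with rfl | h
      · simp
      · rw [lp.single_apply_ne _ _ _ h]; simp [h]
    simp only [this, Finset.sum_ite_eq, Finset.mem_range]
  have hFc : ∀ N, IsCompactOperator (F N) := fun N =>
    (compactOperator (RingHom.id ℂ) (lp (fun _ : ℕ => ℂ) 2) (lp (fun _ : ℕ => ℂ) 2)).sum_mem
      fun k _ => Submodule.smul_mem _ (d k) ((isCompactOperator_of_locallyCompactSpace_dom
        (lp.evalCLM ℂ (fun _ : ℕ => ℂ) 2 k)).clm_comp
          (lp.singleContinuousLinearMap ℂ (fun _ : ℕ => ℂ) 2 k))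
  refine isCompactOperator_of_tendsto (l := atTop) (F := F) ?_ (.of_forall hFc)
  rw [tendsto_iff_norm_sub_tendsto_zero, Metric.tendsto_atTop]
  intro ε hε
  obtain ⟨N, hN⟩ := Metric.tendsto_atTop.1 hd (ε / 2) (half_pos hε)
  refine ⟨N, fun n hn => ?_⟩
  rw [dist_zero_right, norm_norm]
  obtain ⟨G, hG, hGn⟩ := exists_diagonal_clm (d := fun k => if k < n then 0 else -d k)
    (half_pos hε).le fun k => by
      split_ifs with h
      · simpa using (half_pos hε).le
      · simpa using (hN k (hn.trans (not_lt.1 h))).le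
  have : F n - D = G := by
    ext x k
    rw [hG, sub_apply, lp.coeFn_sub, Pi.sub_apply, hF, hD]
    split_ifs <;> simp
  rw [this]
  exact hGn.trans_lt (half_lt_self hε)

/-- Parseval's identity for a complete orthogonal family. -/
theorem hasSum_inner_mul_inner_div {ι E : Type*} [NormedAddCommGroup E] [InnerProductSpace ℂ E]
    [CompleteSpace E] {v : ι → E} (hv0 : ∀ i, v i ≠ 0) (hv : ∀ i j, i ≠ j → ⟪v i, v j⟫_ℂ = 0)
    (hcomp : ∀ u, (∀ i, ⟪v i, u⟫_ℂ = 0) → u = 0) (x y : E) :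
    HasSum (fun i => ⟪x, v i⟫_ℂ * ⟪v i, y⟫_ℂ / ((‖v i‖ ^ 2 : ℝ) : ℂ)) ⟪x, y⟫_ℂ := by
  have hon : Orthonormal ℂ fun i => ((‖v i‖⁻¹ : ℝ) : ℂ) • v i := by
    refine ⟨fun i => ?_, fun i j hij => ?_⟩
    · rw [norm_smul, Complex.norm_real, norm_inv, norm_norm,
        inv_mul_cancel₀ (norm_ne_zero_iff.2 (hv0 i))]
    · simp only [inner_smul_left, inner_smul_right, hv i j hij, mul_zero]
  have hbot : (Submodule.span ℂ (Set.range fun i => ((‖v i‖⁻¹ : ℝ) : ℂ) • v i))ᗮ = ⊥ := by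
    rw [Submodule.eq_bot_iff]
    intro u hu
    refine hcomp u fun i => ?_
    have := Submodule.mem_orthogonal _ _ |>.1 hu _ (Submodule.subset_span ⟨i, rfl⟩)
    simpa [inner_smul_left, hv0 i] using this
  have := (HilbertBasis.mkOfOrthogonalEqBot hon hbot).hasSum_inner_mul_inner x y
  simp only [HilbertBasis.coe_mkOfOrthogonalEqBot, inner_smul_left, inner_smul_right,
    Complex.conj_ofReal] at this
  convert! this using 1
  ext i
  have : (‖v i‖ : ℂ) ≠ 0 := by exact_mod_cast norm_ne_zero_iff.2 (hv0 i)
  push_cast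
  field_simp

theorem lp.hasSum_inner_ofReal {p : ℕ → ℝ} {q : ℕ → ℂ} {x y : lp (fun _ : ℕ => ℂ) 2}
    (hx : ∀ k, x k = p k) (hy : ∀ k, y k = q k) : HasSum (fun k => (p k : ℂ) * q k) ⟪x, y⟫_ℂ := by
  have := lp.hasSum_inner (𝕜 := ℂ) x y
  simpa only [RCLike.inner_apply, hx, hy, Complex.conj_ofReal, mul_comm] using this

theorem lp.exists_sqrt {c : ℕ → ℝ} (hc : ∀ k, 0 < c k) (hcsum : Summable c) :
    ∃ e : lp (fun _ : ℕ => ℂ) 2, ∀ k, e k = (√(c k) : ℝ) := by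
  have : Memℓp (fun k => ((√(c k) : ℝ) : ℂ)) 2 := by
    refine memℓp_gen ?_
    simpa [Complex.norm_real, abs_of_nonneg, Real.sq_sqrt (hc _).le] using hcsum
  exact ⟨⟨_, this⟩, fun _ => rfl⟩

/-! ### Completeness of the eigenvectors. -/

/-- A vector orthogonal to `√c` and to all the vectors `√c / (lam - t n)` vanishes: these are,
up to scaling, the eigenvectors of the compression of `diag lam` to the complement of `√c`. -/
theorem eq_zero_of_inner_eq_zero {c lam t : ℕ → ℝ} (hc : ∀ k, 0 < c k)
    (hlam : StrictMono lam) (hbdd : BddAbove (Set.range lam))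
    (ht : ∀ z ∈ wolffDenjoyDomain c lam, wolffDenjoy c lam z = 0 → ∃ n, z = (t n : ℂ))
    {e : lp (fun _ : ℕ => ℂ) 2} (he : ∀ k, e k = (√(c k) : ℝ))
    {v : ℕ → lp (fun _ : ℕ => ℂ) 2} (hv : ∀ n k, v n k = ((√(c k) / (lam k - t n) : ℝ) : ℂ))
    {u : lp (fun _ : ℕ => ℂ) 2} (heu : ⟪e, u⟫_ℂ = 0) (hvu : ∀ n, ⟪v n, u⟫_ℂ = 0) : u = 0 := by
  set S := ⨆ k, lam k with hS
  have hsq : ∀ k, (√(c k) : ℂ) ≠ 0 := fun k => by exact_mod_cast (Real.sqrt_pos.2 (hc k)).ne'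
  have hcsq : ∀ k, (√(c k) : ℂ) * √(c k) = c k := fun k => by
    exact_mod_cast Real.mul_self_sqrt (hc k).le
  -- Subtracting `S` keeps the eigenvectors and makes the diagonal operator compact.
  have hd : Tendsto (fun k => ((lam k - S : ℝ) : ℂ)) atTop (𝓝 0) := by
    have := (tendsto_atTop_ciSup hlam.monotone hbdd).sub_const S
    rw [← hS, sub_self] at this
    exact_mod_cast (Complex.continuous_ofReal.tendsto _).comp this
  obtain ⟨D, hD, -⟩ := exists_diagonal_clm (d := fun k => ((lam k - S : ℝ) : ℂ)) (B := S - lam 0)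
    (sub_nonneg.2 (le_ciSup hbdd 0)) fun k => by
      rw [Complex.norm_real, Real.norm_of_nonpos (sub_nonpos.2 (le_ciSup hbdd k))]
      linarith [hlam.monotone k.zero_le]
  have hDsymm : ∀ x y, ⟪D x, y⟫_ℂ = ⟪x, D y⟫_ℂ := fun x y => by
    rw [lp.inner_eq_tsum, lp.inner_eq_tsum]
    refine tsum_congr fun k => ?_
    simp only [RCLike.inner_apply, hD, map_mul, Complex.conj_ofReal]
    ring
  set P := (ℂ ∙ e)ᗮ.starProjection with hP
  have hPsymm : ∀ x y, ⟪P x, y⟫_ℂ = ⟪x, P y⟫_ℂ := fun x y =>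
    Submodule.inner_starProjection_left_eq_right _ x y
  have hPe : ∀ x, ⟪e, P x⟫_ℂ = 0 := fun x =>
    Submodule.mem_orthogonal_singleton_iff_inner_right.1 (Submodule.starProjection_apply_mem _ x)
  have hPfix : ∀ x, ⟪e, x⟫_ℂ = 0 → P x = x := fun x hx =>
    Submodule.starProjection_eq_self_iff.2 (Submodule.mem_orthogonal_singleton_iff_inner_right.2 hx)
  have key : ∀ (μ : ℂ) x, ⟪e, x⟫_ℂ = 0 → P (D x) = μ • x → ⟪x, u⟫_ℂ = 0 := by
    intro μ x hex hx
    obtain ⟨s, hs⟩ : ∃ s : ℂ, s • e = D x - μ • x := by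
      refine Submodule.mem_span_singleton.1 ?_
      rw [← hx, hP, Submodule.starProjection_orthogonal_val, sub_sub_cancel]
      exact Submodule.starProjection_apply_mem _ _
    have hcoord : ∀ k, s * √(c k) = (lam k - (S + μ)) * x k := fun k => by
      have := congrArg (fun y : lp (fun _ : ℕ => ℂ) 2 => y k) hs
      simp only [lp.coeFn_sub, lp.coeFn_smul, Pi.sub_apply, Pi.smul_apply, hD, he, smul_eq_mul]
        at this
      rw [this]
      push_cast
      ring
    have hex' := lp.hasSum_inner_ofReal he (fun k => rfl : ∀ k, x k = x k)
    rw [hex] at hex'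
    -- If `s = 0`, then `x` is an eigenvector of `D` itself, hence supported on one coordinate, and
    -- cannot be orthogonal to `e`.
    rcases eq_or_ne s 0 with rfl | hs0
    · suffices x = 0 by rw [this, inner_zero_left]
      by_contra hx0
      obtain ⟨k, hk⟩ : ∃ k, x k ≠ 0 := by
        by_contra! h
        exact hx0 (by ext k; exact h k)
      have hk' : (lam k : ℂ) = S + μ := by
        have := hcoord k
        rw [zero_mul, zero_eq_mul] at this
        exact sub_eq_zero.1 (this.resolve_right hk)
      have := hex'.unique (hasSum_single k fun j hj => by
        have hj' := hcoord j
        rw [zero_mul, zero_eq_mul, ← hk', sub_eq_zero, Complex.ofReal_inj] at hj'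
        rw [hj'.resolve_left fun h => hj (hlam.injective h), mul_zero])
      exact mul_ne_zero (hsq k) hk this.symm
    -- Otherwise `x` is `s` times `√c / (lam - (S + μ))`, and orthogonality to `e` says that `S + μ`
    -- is a zero of `f`.
    · have hne : ∀ k, (lam k : ℂ) - (S + μ) ≠ 0 := fun k h => by
        have := hcoord k
        rw [h, zero_mul] at this
        exact mul_ne_zero hs0 (hsq k) this
      have hxk : ∀ k, x k = s * (√(c k) / (lam k - (S + μ))) := fun k => by
        rw [← mul_div_assoc, hcoord, mul_div_cancel_left₀ _ (hne k)]
      have hsum : HasSum (fun k => (c k : ℂ) / ((lam k : ℂ) - (S + μ))) 0 := by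
        have := hex'.mul_left s⁻¹
        rw [mul_zero] at this
        convert! this using 1
        ext k
        rw [hxk, ← hcsq]
        field_simp
      obtain ⟨n, hn⟩ := ht (S + μ) ⟨fun k h => hne k (by rw [h, sub_self]), hsum.summable⟩
        hsum.tsum_eq
      have : x = s • v n := by
        ext k
        rw [lp.coeFn_smul, Pi.smul_apply, hv, hxk, hn, smul_eq_mul]
        push_cast
        rfl
      rw [this, inner_smul_left, hvu, mul_zero]
  have hcomp : IsCompactOperator (P ∘L D ∘L P) :=
    ((isCompactOperator_of_diagonal hd hD).comp_clm P).clm_comp P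
  have hsymm : ((P ∘L D ∘L P : lp (fun _ : ℕ => ℂ) 2 →L[ℂ] lp (fun _ : ℕ => ℂ) 2) :
      lp (fun _ : ℕ => ℂ) 2 →ₗ[ℂ] lp (fun _ : ℕ => ℂ) 2).IsSymmetric := fun x y => by
    change ⟪P (D (P x)), y⟫_ℂ = ⟪x, P (D (P y))⟫_ℂ
    rw [hPsymm, hDsymm, hPsymm]
  -- Spectral theorem: it suffices that `u` be orthogonal to every eigenspace of `P D P`.
  rw [← Submodule.mem_bot ℂ,
    ← ContinuousLinearMap.orthogonalComplement_iSup_eigenspaces_eq_bot hcomp hsymm,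
    ← Submodule.iInf_orthogonal, Submodule.mem_iInf]
  intro μ
  rw [Submodule.mem_orthogonal]
  intro w hw
  have hw' : P (D (P w)) = μ • w := Module.End.mem_eigenspace_iff.1 hw
  rw [← hPfix u heu, ← hPsymm]
  refine key μ (P w) (hPe w) ?_
  have := congrArg P hw'
  rwa [map_smul, hPfix _ (hPe _)] at this

/-! ### The expansion of `1 / f` from Parseval's identity. -/

/-- The partial fraction expansion of `1 / f` off the closure of the poles. -/
theorem hasSum_one_div_wolffDenjoy {c lam t N : ℕ → ℝ} (hc : ∀ k, 0 < c k) (hcsum : Summable c)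
    (hlam : StrictMono lam) (hbdd : BddAbove (Set.range lam)) (htinj : Function.Injective t)
    (ht : ∀ z ∈ wolffDenjoyDomain c lam, wolffDenjoy c lam z = 0 → ∃ n, z = (t n : ℂ))
    (htlam : ∀ n k, (t n : ℂ) ≠ lam k) (htS : ∀ n, (t n : ℂ) ≠ ((⨆ k, lam k : ℝ) : ℂ))
    (ht0 : ∀ n, wolffDenjoy c lam (t n) = 0)
    (hN : ∀ n, HasSum (fun k => c k / (lam k - t n) ^ 2) (N n)) (hNpos : ∀ n, 0 < N n) :
    Summable (fun n => 1 / N n) ∧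
      ∀ z, (∀ k, z ≠ (lam k : ℂ)) → z ≠ ((⨆ k, lam k : ℝ) : ℂ) → wolffDenjoy c lam z ≠ 0 →
        HasSum (fun n => ((1 / N n : ℝ) : ℂ) / ((t n : ℂ) - z))
          ((((∑' k, c k * lam k) / (∑' k, c k) ^ 2 : ℝ) : ℂ) + ((-1 / ∑' k, c k : ℝ) : ℂ) * z
            - 1 / wolffDenjoy c lam z) := by
  obtain ⟨e, he⟩ := lp.exists_sqrt hc hcsum
  have hmk : ∀ z, (∀ k, z ≠ (lam k : ℂ)) → z ≠ ((⨆ k, lam k : ℝ) : ℂ) →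
      ∃ x : lp (fun _ : ℕ => ℂ) 2, ∀ k, x k = √(c k) / ((lam k : ℂ) - z) := fun z hz hz' => by
    obtain ⟨δ, hδ, h⟩ := exists_pos_le_norm_sub hlam hbdd hz hz'
    obtain ⟨D, hD, -⟩ := exists_diagonal_clm (d := fun k => ((lam k : ℂ) - z)⁻¹)
      (inv_pos.2 hδ).le fun k => by rw [norm_inv]; exact inv_anti₀ hδ (h k)
    exact ⟨D e, fun k => by rw [hD, he, mul_comm, div_eq_mul_inv]⟩
  choose v hv using fun n => hmk (t n) (htlam n) (htS n)
  have hv' : ∀ n k, v n k = ((√(c k) / (lam k - t n) : ℝ) : ℂ) := fun n k => by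
    rw [hv]; push_cast; rfl
  obtain ⟨a, ha⟩ : ∃ a : lp (fun _ : ℕ => ℂ) 2, ∀ k, a k = ((lam k * √(c k) : ℝ) : ℂ) := by
    obtain ⟨D, hD, -⟩ := exists_diagonal_clm (d := fun k => (lam k : ℂ))
      (B := max |lam 0| |⨆ k, lam k|) (le_max_of_le_left (abs_nonneg _)) fun k => by
        rw [Complex.norm_real, Real.norm_eq_abs]
        exact abs_le_max_abs_abs (hlam.monotone k.zero_le) (le_ciSup hbdd k)
    exact ⟨D e, fun k => by rw [hD, he]; push_cast; rfl⟩
  have hcsq : ∀ k, (√(c k) : ℂ) * √(c k) = c k := fun k => by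
    exact_mod_cast Real.mul_self_sqrt (hc k).le
  have hsumf : ∀ z, (∀ k, z ≠ (lam k : ℂ)) → z ≠ ((⨆ k, lam k : ℝ) : ℂ) →
      HasSum (fun k => (c k : ℂ) / ((lam k : ℂ) - z)) (wolffDenjoy c lam z) := fun z hz hz' =>
    (mem_wolffDenjoyDomain hc hcsum hlam hbdd hz hz').2.hasSum
  set C := ∑' k, c k with hC
  set M := ∑' k, c k * lam k with hM
  have hCpos : 0 < C := hcsum.tsum_pos (fun k => (hc k).le) 0 (hc 0)
  have hCsum : HasSum (fun k => (c k : ℂ)) C := Complex.hasSum_ofReal.2 hcsum.hasSum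
  -- the inner products
  have hee : ⟪e, e⟫_ℂ = C := (lp.hasSum_inner_ofReal he he).unique (by simpa only [hcsq] using hCsum)
  have hey : ∀ z, (∀ k, z ≠ (lam k : ℂ)) → z ≠ ((⨆ k, lam k : ℝ) : ℂ) →
      ∀ y : lp (fun _ : ℕ => ℂ) 2, (∀ k, y k = √(c k) / ((lam k : ℂ) - z)) →
      ⟪e, y⟫_ℂ = wolffDenjoy c lam z := fun z hz hz' y hy =>
    (lp.hasSum_inner_ofReal he hy).unique
      (by simpa only [← mul_div_assoc, hcsq] using hsumf z hz hz')
  have hay : ∀ z, (∀ k, z ≠ (lam k : ℂ)) → z ≠ ((⨆ k, lam k : ℝ) : ℂ) →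
      ∀ y : lp (fun _ : ℕ => ℂ) 2, (∀ k, y k = √(c k) / ((lam k : ℂ) - z)) →
      ⟪a, y⟫_ℂ = C + z * wolffDenjoy c lam z := fun z hz hz' y hy => by
    refine (lp.hasSum_inner_ofReal ha hy).unique ?_
    convert! hCsum.add ((hsumf z hz hz').mul_left z) using 1
    ext k
    have := sub_ne_zero.2 (hz k).symm
    rw [← hcsq]
    push_cast
    field_simp
    ring
  have hae : ⟪a, e⟫_ℂ = M := by
    have h := lp.hasSum_inner_ofReal ha he
    have h1 : ∀ k, ((lam k * √(c k) : ℝ) : ℂ) * (√(c k) : ℂ) = ((c k * lam k : ℝ) : ℂ) := fun k => by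
      push_cast
      rw [mul_assoc, hcsq, mul_comm]
    simp only [h1] at h
    rw [← h.tsum_eq, ← Complex.ofReal_tsum]
  have hvy : ∀ n z, (∀ k, z ≠ (lam k : ℂ)) → z ≠ ((⨆ k, lam k : ℝ) : ℂ) → z ≠ t n →
      ∀ y : lp (fun _ : ℕ => ℂ) 2, (∀ k, y k = √(c k) / ((lam k : ℂ) - z)) →
      ⟪v n, y⟫_ℂ = wolffDenjoy c lam z / (z - t n) := fun n z hz hz' hzt y hy => by
    refine (lp.hasSum_inner_ofReal (hv' n) hy).unique ?_
    have := ((hsumf z hz hz').sub (hsumf _ (htlam n) (htS n))).div_const (z - t n)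
    rw [ht0, sub_zero] at this
    convert! this using 1
    ext k
    have h1 := sub_ne_zero.2 (hz k).symm
    have h2 := sub_ne_zero.2 (htlam n k).symm
    have h3 := sub_ne_zero.2 hzt
    rw [← hcsq]
    push_cast
    field_simp
    ring
  have hvn : ∀ n, ⟪v n, v n⟫_ℂ = N n := fun n => by
    refine (lp.hasSum_inner_ofReal (hv' n) (hv n)).unique ?_
    convert! Complex.hasSum_ofReal.2 (hN n) using 1
    ext k
    have h2 := sub_ne_zero.2 (htlam n k).symm
    push_cast
    rw [← hcsq]
    field_simp
  -- Index `0` carries `e`; its Parseval term, split off below, yields `α`.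
  let w : ℕ → lp (fun _ : ℕ => ℂ) 2 := fun n => Nat.casesOn n e v
  have hnorm : ∀ (x : lp (fun _ : ℕ => ℂ) 2) (r : ℝ), ⟪x, x⟫_ℂ = r → ‖x‖ ^ 2 = r := fun x r h => by
    rw [← inner_self_eq_norm_sq (𝕜 := ℂ), h]
    rfl
  have hev : ∀ n, ⟪e, v n⟫_ℂ = 0 := fun n => by rw [hey _ (htlam n) (htS n) _ (hv n), ht0]
  have hw0 : ∀ i, w i ≠ 0 := by
    rintro (_ | n) h
    · have := hnorm e C hee
      rw [show e = 0 from h, norm_zero] at this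
      simp [hCpos.ne] at this
    · have := hnorm _ _ (hvn n)
      rw [show v n = 0 from h, norm_zero] at this
      simp [(hNpos n).ne] at this
  have hw : ∀ i j, i ≠ j → ⟪w i, w j⟫_ℂ = 0 := by
    rintro (_ | m) (_ | n) hmn
    · exact absurd rfl hmn
    · exact hev n
    · exact inner_eq_zero_symm.1 (hev m)
    · change ⟪v m, v n⟫_ℂ = 0
      rw [hvy m _ (htlam n) (htS n) (fun h => hmn ?_) _ (hv n), ht0, zero_div]
      rw [htinj (Complex.ofReal_inj.1 h)]
  have hcomp : ∀ u, (∀ i, ⟪w i, u⟫_ℂ = 0) → u = 0 := fun u hu =>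
    eq_zero_of_inner_eq_zero hc hlam hbdd ht he hv' (hu 0) fun n => hu (n + 1)
  have hparseval : ∀ y, HasSum (fun n => C * ⟪v n, y⟫_ℂ / N n) (⟪a, y⟫_ℂ - M * ⟪e, y⟫_ℂ / C) := by
    intro y
    have h := (hasSum_nat_add_iff' 1).2 (hasSum_inner_mul_inner_div hw0 hw hcomp a y)
    rw [Finset.sum_range_one] at h
    change HasSum (fun n => ⟪a, v n⟫_ℂ * ⟪v n, y⟫_ℂ / ((‖v n‖ ^ 2 : ℝ) : ℂ))
      (⟪a, y⟫_ℂ - ⟪a, e⟫_ℂ * ⟪e, y⟫_ℂ / ((‖e‖ ^ 2 : ℝ) : ℂ)) at h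
    simpa only [hnorm e C hee, fun n => hnorm _ _ (hvn n), hae,
      fun n => hay _ (htlam n) (htS n) _ (hv n), ht0, mul_zero, add_zero] using h
  have hCne : (C : ℂ) ≠ 0 := by exact_mod_cast hCpos.ne'
  refine ⟨?_, fun z hz hz' hfz => ?_⟩
  -- With `y = a` the Parseval terms are `C ^ 2 / N n`.
  · have h := (hparseval a).summable.mul_left ((C : ℂ) ^ 2)⁻¹
    rw [← Complex.summable_ofReal]
    convert! h using 1
    ext n
    have h1 : ⟪v n, a⟫_ℂ = C := by
      rw [← inner_conj_symm, hay _ (htlam n) (htS n) _ (hv n), ht0, mul_zero, add_zero,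
        Complex.conj_ofReal]
    rw [h1]
    push_cast
    field_simp
  · obtain ⟨y, hy⟩ := hmk z hz hz'
    have hzt : ∀ n, z ≠ t n := fun n h => hfz (h ▸ ht0 n)
    have h := (hparseval y).mul_left (-1 / (C * wolffDenjoy c lam z))
    simp only [fun n => hvy n z hz hz' (hzt n) y hy, hey z hz hz' y hy, hay z hz hz' y hy] at h
    convert! h using 1
    · ext n
      have h1 := sub_ne_zero.2 (hzt n)
      have h2 := sub_ne_zero.2 (hzt n).symm
      have h3 : (N n : ℂ) ≠ 0 := by exact_mod_cast (hNpos n).ne'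
      push_cast
      rw [← neg_sub z]
      field_simp
    · push_cast
      field_simp
      ring

/-! ### Passage to the limit point of the poles. -/

/-- Moving right from `S` shrinks every term in absolute value, so the series at `S` dominates. -/
theorem tendsto_tsum_div_sub_nhdsGT {b p : ℕ → ℝ} {S : ℝ} (hb : ∀ k, 0 < b k) (hp : ∀ k, p k < S)
    (hs : Summable fun k => b k / (p k - S)) :
    Tendsto (fun x => ∑' k, b k / (p k - x)) (𝓝[>] S) (𝓝 (∑' k, b k / (p k - S))) := by
  refine tendsto_tsum_of_dominated_convergence hs.norm (fun k => ?_) ?_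
  · have : ContinuousAt (fun x => b k / (p k - x)) S :=
      continuousAt_const.div (by fun_prop) (sub_neg.2 (hp k)).ne
    exact this.tendsto.mono_left nhdsWithin_le_nhds
  · filter_upwards [self_mem_nhdsWithin] with x hx k
    have h1 := hp k
    have h2 : S < x := hx
    simp only [Real.norm_eq_abs, abs_div, abs_of_pos (hb k)]
    rw [abs_of_neg (by linarith), abs_of_neg (by linarith)]
    exact div_le_div_of_nonneg_left (hb k).le (by linarith) (by linarith)

/-- An expansion in simple fractions valid to the right of `S` extends to `S`. -/
theorem hasSum_div_sub_of_nhdsGT {b p : ℕ → ℝ} {S : ℝ} {G : ℝ → ℝ} (hb : ∀ k, 0 < b k)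
    (hp : ∀ k, p k < S) (hG : Tendsto G (𝓝[>] S) (𝓝 (G S)))
    (h : ∀ x, S < x → HasSum (fun k => b k / (p k - x)) (G x)) :
    HasSum (fun k => b k / (p k - S)) (G S) := by
  have hs : Summable fun k => b k / (p k - S) := by
    -- All terms have one sign, so finite sums to the right of `S` are bounded by `-G x`; the bound
    -- survives the limit.
    refine Summable.of_neg (summable_of_sum_le (c := -G S) (fun k => ?_) fun s => ?_)
    · exact neg_nonneg.2 (div_neg_of_pos_of_neg (hb k) (sub_neg.2 (hp k))).le
    · have h1 : Tendsto (fun x => ∑ k ∈ s, -(b k / (p k - x))) (𝓝[>] S)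
          (𝓝 (∑ k ∈ s, -(b k / (p k - S)))) := by
        refine tendsto_finsetSum _ fun k _ => ?_
        have : ContinuousAt (fun x => -(b k / (p k - x))) S :=
          (continuousAt_const.div (by fun_prop) (sub_neg.2 (hp k)).ne).neg
        exact this.tendsto.mono_left nhdsWithin_le_nhds
      refine le_of_tendsto_of_tendsto h1 hG.neg ?_
      filter_upwards [self_mem_nhdsWithin] with x hx
      exact sum_le_hasSum s (fun k _ => neg_nonneg.2 (div_neg_of_pos_of_neg (hb k)
        (sub_neg.2 ((hp k).trans hx))).le) (h x hx).neg
  have := tendsto_nhds_unique ((tendsto_tsum_div_sub_nhdsGT hb hp hs).congr' ?_) hG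
  · exact this ▸ hs.hasSum
  · filter_upwards [self_mem_nhdsWithin] with x hx
    exact (h x hx).tsum_eq

/-! ### The main theorem. -/

theorem mainTheorem1 (c lam : ℕ → ℝ) (hc : ∀ k, 0 < c k) (hcsum : Summable c)
    (hlam : StrictMono lam) (hbdd : BddAbove (Set.range lam)) :
    -- the series converges off the poles and their limit point
    (∀ z : ℂ, (∀ k, z ≠ (lam k : ℂ)) → z ≠ ((⨆ k, lam k : ℝ) : ℂ) →
      z ∈ wolffDenjoyDomain c lam) ∧
    Summable (fun k => c k * lam k) ∧
    ∃ t b : ℕ → ℝ,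
      StrictMono t ∧
      -- the `t n` are all the zeros of `f` in the complex plane
      {z | z ∈ wolffDenjoyDomain c lam ∧ wolffDenjoy c lam z = 0} =
        Set.range (fun n => (t n : ℂ)) ∧
      -- exactly one zero between consecutive poles
      (∀ n, t n ∈ Set.Ioo (lam n) (lam (n + 1))) ∧
      (∀ n, ∃! x : ℝ, x ∈ Set.Ioo (lam n) (lam (n + 1)) ∧ wolffDenjoy c lam (x : ℂ) = 0) ∧
      -- the zeros are simple
      (∀ n, analyticOrderAt (wolffDenjoy c lam) (t n : ℂ) = 1) ∧
      (∀ n, (b n : ℂ) = 1 / deriv (wolffDenjoy c lam) (t n : ℂ)) ∧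
      (∀ n, 0 < b n) ∧
      Summable b ∧
      ∀ z ∈ wolffDenjoyDomain c lam, wolffDenjoy c lam z ≠ 0 →
        Summable (fun n => (b n : ℂ) / ((t n : ℂ) - z)) ∧
        1 / wolffDenjoy c lam z =
          (((∑' k, c k * lam k) / (∑' k, c k) ^ 2 : ℝ) : ℂ) + ((-1 / ∑' k, c k : ℝ) : ℂ) * z
            - ∑' n, (b n : ℂ) / ((t n : ℂ) - z) := by
  have hdom : ∀ z : ℂ, (∀ k, z ≠ (lam k : ℂ)) → z ≠ ((⨆ k, lam k : ℝ) : ℂ) →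
      z ∈ wolffDenjoyDomain c lam := fun z hz hz' => mem_wolffDenjoyDomain hc hcsum hlam hbdd hz hz'
  have hcl : Summable fun k => c k * lam k := by
    refine .of_norm_bounded (hcsum.mul_right (max |lam 0| |⨆ k, lam k|)) fun k => ?_
    rw [norm_mul, Real.norm_of_nonneg (hc k).le, Real.norm_eq_abs]
    exact mul_le_mul_of_nonneg_left
      (abs_le_max_abs_abs (hlam.monotone k.zero_le) (le_ciSup hbdd k)) (hc k).le
  choose t htmem ht0 using fun n => exists_wolffDenjoy_eq_zero hc hcsum hlam hbdd n
  have htlam : ∀ n k, (t n : ℂ) ≠ lam k := fun n k => ne_of_mem_Ioo hlam (htmem n) k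
  have htS : ∀ n, (t n : ℂ) ≠ ((⨆ k, lam k : ℝ) : ℂ) := fun n => ne_ciSup_of_mem_Ioo hbdd (htmem n)
  have htmono : StrictMono t := strictMono_nat_of_lt_succ fun n =>
    (htmem n).2.trans (htmem (n + 1)).1
  have huniq : ∀ n x, x ∈ Set.Ioo (lam n) (lam (n + 1)) → wolffDenjoy c lam (x : ℂ) = 0 →
      x = t n := fun n x hx hx0 => by
    have hs : ∀ y ∈ Set.Ioo (lam n) (lam (n + 1)), Summable fun k => c k / (lam k - y) :=
      fun y hy => summable_real_of_mem_wolffDenjoyDomain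
        (hdom y (ne_of_mem_Ioo hlam hy) (ne_ciSup_of_mem_Ioo hbdd hy))
    have h1 := ht0 n
    rw [wolffDenjoy_ofReal, Complex.ofReal_eq_zero] at hx0 h1
    rcases lt_trichotomy x (t n) with h | h | h
    · have := tsum_div_sub_lt_of_mem_Ioo hc hlam hx (htmem n) (hs _ hx) (hs _ (htmem n)) h
      linarith
    · exact h
    · have := tsum_div_sub_lt_of_mem_Ioo hc hlam (htmem n) hx (hs _ (htmem n)) (hs _ hx) h
      linarith
  have ht : ∀ z ∈ wolffDenjoyDomain c lam, wolffDenjoy c lam z = 0 → ∃ n, z = (t n : ℂ) := by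
    intro z hz hz0
    obtain ⟨n, x, hx, rfl⟩ := exists_mem_Ioo_of_wolffDenjoy_eq_zero hc hlam hz hz0
    exact ⟨n, by rw [huniq n x hx hz0]⟩
  have hderiv : ∀ n, ∃ N, HasSum (fun k => c k / (lam k - t n) ^ 2) N ∧ 0 < N ∧
      deriv (wolffDenjoy c lam) (t n) = N ∧ AnalyticAt ℂ (wolffDenjoy c lam) (t n) := fun n => by
    obtain ⟨δ, hδ, h⟩ := exists_pos_le_norm_sub hlam hbdd (htlam n) (htS n)
    obtain ⟨hd, hs⟩ := differentiableOn_wolffDenjoy_ball hc hcsum hδ h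
    have hs' : HasSum (fun k => ((c k / (lam k - t n) ^ 2 : ℝ) : ℂ))
        (deriv (wolffDenjoy c lam) (t n)) := by
      simpa only [Complex.ofReal_div, Complex.ofReal_pow, Complex.ofReal_sub] using hs
    have hsr := (Complex.summable_ofReal.1 hs'.summable)
    have hp : ∀ k, 0 < c k / (lam k - t n) ^ 2 := fun k =>
      div_pos (hc k) (sq_pos_iff.2 (fun h => htlam n k (by rw [sub_eq_zero.1 h])))
    exact ⟨_, hsr.hasSum, hsr.tsum_pos (fun k => (hp k).le) 0 (hp 0),
      hs'.unique (Complex.hasSum_ofReal.2 hsr.hasSum),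
      hd.analyticAt (Metric.ball_mem_nhds _ (half_pos hδ))⟩
  choose N hN hNpos hNd han using hderiv
  obtain ⟨hbsum, hform⟩ := hasSum_one_div_wolffDenjoy hc hcsum hlam hbdd htmono.injective ht htlam
    htS ht0 hN hNpos
  have hbpos : ∀ n, 0 < 1 / N n := fun n => one_div_pos.2 (hNpos n)
  refine ⟨hdom, hcl, t, fun n => 1 / N n, htmono, ?_, htmem,
    fun n => ⟨t n, ⟨htmem n, ht0 n⟩, fun x hx => huniq n x hx.1 hx.2⟩,
    fun n => (han n).analyticOrderAt_eq_one_of_zero_deriv_ne_zero (ht0 n) ?_,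
    fun n => by rw [hNd]; push_cast; rfl, hbpos, hbsum, fun z hz hz0 => ?_⟩
  · ext z
    constructor
    · rintro ⟨hz, hz0⟩
      obtain ⟨n, rfl⟩ := ht z hz hz0
      exact ⟨n, rfl⟩
    · rintro ⟨n, rfl⟩
      exact ⟨hdom _ (htlam n) (htS n), ht0 n⟩
  · rw [hNd]
    exact_mod_cast (hNpos n).ne'
  suffices h : HasSum (fun n => ((1 / N n : ℝ) : ℂ) / ((t n : ℂ) - z))
      ((((∑' k, c k * lam k) / (∑' k, c k) ^ 2 : ℝ) : ℂ) + ((-1 / ∑' k, c k : ℝ) : ℂ) * z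
        - 1 / wolffDenjoy c lam z) from ⟨h.summable, by rw [h.tsum_eq]; ring⟩
  -- The supremum may belong to the domain, where the ℓ² argument fails since `√c / (lam - z)` need
  -- not be square summable.
  by_cases hzS : z = ((⨆ k, lam k : ℝ) : ℂ)
  · subst hzS
    set S := ⨆ k, lam k with hS
    have hlS : ∀ k, lam k < S := fun k => hlam.lt_ciSup_of_bddAbove hbdd k
    have hs := summable_real_of_mem_wolffDenjoyDomain hz
    have hneg := tsum_div_sub_neg hc hlS hs
    have hx : ∀ x, S < x → HasSum (fun n => 1 / N n / (t n - x))
        ((∑' k, c k * lam k) / (∑' k, c k) ^ 2 + (-1 / ∑' k, c k) * x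
          - 1 / ∑' k, c k / (lam k - x)) := fun x hx => by
      have h1 : ∀ k, (x : ℂ) ≠ lam k := fun k h =>
        ((hlS k).trans hx).ne' (Complex.ofReal_inj.1 h)
      have h2 : (x : ℂ) ≠ S := fun h => hx.ne' (Complex.ofReal_inj.1 h)
      have h3 : wolffDenjoy c lam x ≠ 0 := by
        rw [wolffDenjoy_ofReal, Complex.ofReal_ne_zero]
        exact (tsum_div_sub_neg hc (fun k => (hlS k).trans hx)
          (summable_real_of_mem_wolffDenjoyDomain (hdom x h1 h2))).ne
      have := hform x h1 h2 h3
      rw [wolffDenjoy_ofReal] at this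
      exact_mod_cast this
    have hlim := hasSum_div_sub_of_nhdsGT (G := fun x => (∑' k, c k * lam k) / (∑' k, c k) ^ 2
      + (-1 / ∑' k, c k) * x - 1 / ∑' k, c k / (lam k - x)) hbpos
      (fun n => (htmem n).2.trans (hlS _)) ?_ hx
    · rw [wolffDenjoy_ofReal]
      exact_mod_cast hlim
    · have hlin : Continuous fun x : ℝ => (∑' k, c k * lam k) / (∑' k, c k) ^ 2
        + (-1 / ∑' k, c k) * x := by fun_prop
      exact ((hlin.tendsto S).mono_left nhdsWithin_le_nhds).sub
        (tendsto_const_nhds.div (tendsto_tsum_div_sub_nhdsGT hc hlS hs) hneg.ne)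
  · exact hform z hz.1 hzS hz0
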